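/- There are absolute constants $b_1,b_2$ with $0.95<b_1<0.951$ and $0.97<b_2<0.971$ such that the following holds. Let $\chi$ be a primitive Dirichlet character modulo $q\ge 2$, let $t$ be a real number with $|t|\ge 10450+10^3\log\log q$, and assume that $L(z,\chi)\ne 0$ for all complex $z$ with $\Re z>\frac12$ and $|\Im z-t|\le 10^3\log\log\bigl(q(|t|+1)\bigr)+3$. Let $\log L(s,\chi)$ denote the logarithm which for $\Re s>1$ equals $\sum_p\sum_{k\ge1}\chi(p)^k/(kp^{ks})$ and which is continued analytically along the horizontal line to $s=\sigma+it$. Then: (a) for every real $\sigma$ with $\frac12+\frac{0.5}{\log\log(q|t|)}\le\sigma\le 1+\frac{0.5}{\log\log(q|t|)}$, $$\left|\log L(\sigma+it,\chi)\right|\le 5.44\,\bigl(b_1\log(q|t|)\bigr)^{2(1-\sigma)}\log\log(q|t|);$$ (b) for every real $\sigma$ with $\frac12+\frac{1.0051}{\log\log(q|t|)}\le\sigma\le 1+\frac{0.3349}{\log\log(q|t|)}$, $$\left|\frac{L'}{L}(\sigma+it,\chi)\right|\le 33.281\,\bigl(b_2\log(q|t|)\bigr)^{2(1-\sigma)}\bigl(\log\log(q|t|)\bigr)^2.$$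 -/

import Mathlib

noncomputable section

/-- The logarithmic derivative `L'/L (s, χ)`. -/
def dirichletLogDeriv {q : ℕ} [NeZero q] (χ : DirichletCharacter ℂ q) (s : ℂ) : ℂ :=
  deriv (DirichletCharacter.LFunction χ) s / DirichletCharacter.LFunction χ s

/-- The logarithm of the Euler product, `log L(s, χ) = - ∑_p log (1 - χ(p) p^(-s))` with principal
logarithms, i.e. `∑_p ∑_{k ≥ 1} χ(p)^k / (k p^(k s))`. It converges absolutely for `re s > 1`. -/
def eulerLog {q : ℕ} (χ : DirichletCharacter ℂ q) (s : ℂ) : ℂ :=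
  ∑' p : Nat.Primes, -Complex.log (1 - χ p * (p : ℂ) ^ (-s))

/-- The analytic logarithm `log L(s, χ)`, at points `s = σ + i t` such that `L` has no zero (and no
pole) on the horizontal half-line `{u + i t : u ≥ σ}`: the Euler product logarithm at `2 + i t`,
continued analytically along the horizontal segment from `2 + i t` to `σ + i t`. -/
def dirichletLog {q : ℕ} [NeZero q] (χ : DirichletCharacter ℂ q) (s : ℂ) : ℂ :=
  eulerLog χ (2 + s.im * Complex.I) +
    ∫ u in (2 : ℝ)..s.re, dirichletLogDeriv χ (u + s.im * Complex.I)

/-- The half-strip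
`R(C₃, c, t) = {w : re w > 1/2, |im w - t| ≤ C₃ log log (c (|t| + 1)) + 3}`. -/
def regionR (C₃ c t : ℝ) : Set ℂ :=
  {w | 1 / 2 < w.re ∧ |w.im - t| ≤ C₃ * Real.log (Real.log (c * (|t| + 1))) + 3}

/-- The interval `S(A, B, c, t) = [1/2 + A / log log (c |t|), 1 + B / log log (c |t|)]`. -/
def regionS (A B c t : ℝ) : Set ℝ :=
  Set.Icc (1 / 2 + A / Real.log (Real.log (c * |t|))) (1 + B / Real.log (Real.log (c * |t|)))

end

/-! Write L = log(q|t|) and l = log L. The zero-free half-strip is convex, so L(s, χ) has a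
holomorphic logarithm f there, equal to the Euler product logarithm for re s > 1 and to its
continuation along horizontal lines.

Two bounds for f are interpolated. On re s ≥ 1 + 0.5/l, comparison with log ζ(re s) gives |f| ≤ 1.85
l (`norm_le_right`). On re s ≥ 1/2 + 0.5/l, partial summation gives re f = log|L(s, χ)| ≤ L/2 + 3/2,
and Borel–Carathéodory turns this one-sided bound into |f| ≤ 1.85 l L (`norm_le`).

The two bounds differ by a factor L = e^l across a width 1/2, so a three-lines argument
(`norm_le_of_strip`) yields a constant times l L^(2(1-σ)). A Gaussian weight localises it to a
rectangle of height O(l).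

For L'/L, Cauchy's estimate on circles of radius 0.5/l first multiplies both bounds by 2l; the same
interpolation then applies. -/

/-! ### Character sums, partial summation and the trivial bound for L(s, χ) -/

open Finset in
theorem DirichletCharacter.sum_range_level_eq_zero {q : ℕ} [NeZero q] {χ : DirichletCharacter ℂ q}
    (hχ : χ ≠ 1) : ∑ k ∈ range q, χ (k : ZMod q) = 0 := by
  rw [← MulChar.sum_eq_zero_of_ne_one hχ]
  refine Finset.sum_bij (fun k _ => (k : ZMod q)) (fun _ _ => mem_univ _) ?_ ?_ (fun _ _ => rfl)
  · intro a ha b hb h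
    rw [ZMod.natCast_eq_natCast_iff'] at h
    rwa [Nat.mod_eq_of_lt (mem_range.1 ha), Nat.mod_eq_of_lt (mem_range.1 hb)] at h
  · intro b _
    exact ⟨b.val, mem_range.2 (ZMod.val_lt b), ZMod.natCast_zmod_val b⟩

-- Full periods sum to zero and can be removed one at a time, leaving fewer than q terms.
open Finset in
theorem DirichletCharacter.norm_sum_range_le {q : ℕ} [NeZero q] {χ : DirichletCharacter ℂ q}
    (hχ : χ ≠ 1) (n : ℕ) : ‖∑ k ∈ range n, χ (k : ZMod q)‖ ≤ q := by
  induction n using Nat.strong_induction_on with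
  | _ n ih =>
    rcases lt_or_ge n q with h | h
    · refine (norm_sum_le_of_le (range n) fun k _ => χ.norm_le_one (k : ZMod q)).trans ?_
      simpa using h.le
    · obtain ⟨m, rfl⟩ := Nat.exists_eq_add_of_le h
      rw [sum_range_add, sum_range_level_eq_zero hχ, zero_add]
      simpa using ih m (by have := NeZero.pos q; omega)

theorem DirichletCharacter.apply_zero_eq_zero {q : ℕ} {χ : DirichletCharacter ℂ q} (hq : 2 ≤ q) :
    χ 0 = 0 := by
  have : Fact (1 < q) := ⟨hq⟩
  exact χ.map_nonunit not_isUnit_zero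

open Finset in
theorem DirichletCharacter.norm_sum_Icc_le {q : ℕ} [NeZero q] {χ : DirichletCharacter ℂ q}
    (hχ : χ ≠ 1) (n : ℕ) : ‖∑ k ∈ Icc 0 n, χ (k : ZMod q)‖ ≤ q := by
  rw [show Icc 0 n = range (n + 1) by ext; simp]
  exact norm_sum_range_le hχ _

open Finset in
theorem sum_Icc_rpow_neg_half_le (n : ℕ) :
    ∑ k ∈ Icc 1 n, (k : ℝ) ^ (-(1 / 2) : ℝ) ≤ 2 * √n := by
  induction n with
  | zero => simp
  | succ n ih =>
    rw [sum_Icc_succ_top (by omega), Real.rpow_neg (by positivity), ← Real.sqrt_eq_rpow]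
    have h1 : 0 < √((n + 1 : ℕ) : ℝ) := by positivity
    have h2 := Real.sqrt_nonneg (n : ℝ)
    have h3 : √((n + 1 : ℕ) : ℝ) ^ 2 = n + 1 := by rw [Real.sq_sqrt (by positivity)]; simp
    have h4 : √(n : ℝ) ^ 2 = n := Real.sq_sqrt (by positivity)
    have : (√((n + 1 : ℕ) : ℝ))⁻¹ ≤ 2 * √((n + 1 : ℕ) : ℝ) - 2 * √n := by
      rw [inv_le_iff_one_le_mul₀ h1]
      nlinarith [sq_nonneg (√((n + 1 : ℕ) : ℝ) - √n)]
    linarith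

/-- The summatory function of `χ`, cut off to `(N, ∞)`. -/
noncomputable def tailCharSum {q : ℕ} (χ : DirichletCharacter ℂ q) (N : ℕ) : ℝ → ℂ :=
  (Set.Ioi (N : ℝ)).indicator fun x => ∑ k ∈ Finset.Icc 0 ⌊x⌋₊, χ (k : ZMod q)

theorem norm_tailCharSum_le {q : ℕ} [NeZero q] {χ : DirichletCharacter ℂ q} (hχ : χ ≠ 1) (N : ℕ)
    (x : ℝ) : ‖tailCharSum χ N x‖ ≤ q := by
  rw [tailCharSum, norm_indicator_eq_indicator_norm]
  refine Set.indicator_apply_le' (fun _ => ?_) fun _ => Nat.cast_nonneg q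
  exact DirichletCharacter.norm_sum_Icc_le hχ _

-- Makes the tail integral of partial summation holomorphic: the function is bounded at infinity and
-- vanishes near 0, so any lower exponent, here `s.re - 1`, is admissible.
open MeasureTheory Asymptotics Filter Topology in
theorem tailCharSum_differentiableAt_mellin {q : ℕ} [NeZero q] {χ : DirichletCharacter ℂ q}
    (hχ : χ ≠ 1) {N : ℕ} (hN : 1 ≤ N) {s : ℂ} (hs : s.re < 0) :
    DifferentiableAt ℂ (mellin (tailCharSum χ N)) s := by
  have hm : Measurable (tailCharSum χ N) := by
    refine Measurable.indicator ?_ measurableSet_Ioi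
    exact (measurable_of_countable fun n : ℕ => ∑ k ∈ Finset.Icc 0 n, χ (k : ZMod q)).comp
      Nat.measurable_floor
  have hloc : LocallyIntegrable (tailCharSum χ N) := by
    refine (locallyIntegrable_const (q : ℝ)).mono hm.aestronglyMeasurable ?_
    exact .of_forall fun x => by simpa using norm_tailCharSum_le hχ N x
  refine mellin_differentiableAt_of_isBigO_rpow (a := 0) (b := s.re - 1)
    (hloc.locallyIntegrableOn _) ?_ hs ?_ (by linarith)
  · simp only [neg_zero, Real.rpow_zero]
    exact IsBigO.of_bound q (.of_forall fun x => by simpa using norm_tailCharSum_le hχ N x)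
  · have : tailCharSum χ N =ᶠ[𝓝[>] 0] 0 := by
      filter_upwards [nhdsWithin_le_nhds (Iio_mem_nhds (zero_lt_one' ℝ))] with x hx
      refine Set.indicator_of_notMem ?_ _
      have : (1 : ℝ) ≤ N := by exact_mod_cast hN
      simp only [Set.mem_Ioi, not_lt]
      exact hx.le.trans this
    exact this.trans_isBigO (isBigO_zero _ _)

open MeasureTheory in
theorem mellin_tailCharSum {q : ℕ} {χ : DirichletCharacter ℂ q} {N : ℕ} (s : ℂ) :
    mellin (tailCharSum χ N) (-s) =
      ∫ x in Set.Ioi (N : ℝ), (x : ℂ) ^ (-s - 1) * ∑ k ∈ Finset.Icc 0 ⌊x⌋₊, χ (k : ZMod q) := by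
  rw [mellin, ← integral_indicator measurableSet_Ioi, ← integral_indicator measurableSet_Ioi]
  congr 1 with x
  by_cases hx : x ∈ Set.Ioi (N : ℝ)
  · have : x ∈ Set.Ioi (0 : ℝ) := (Nat.cast_nonneg N).trans_lt (Set.mem_Ioi.1 hx)
    rw [Set.indicator_of_mem hx, Set.indicator_of_mem this, tailCharSum, Set.indicator_of_mem hx,
      smul_eq_mul]
  · rw [Set.indicator_of_notMem hx, tailCharSum]
    by_cases h0 : x ∈ Set.Ioi (0 : ℝ)
    · rw [Set.indicator_of_mem h0, Set.indicator_of_notMem hx, smul_zero]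
    · rw [Set.indicator_of_notMem h0]

open MeasureTheory in
theorem norm_mellin_tailCharSum_le {q : ℕ} [NeZero q] {χ : DirichletCharacter ℂ q} (hχ : χ ≠ 1)
    {N : ℕ} (hN : 1 ≤ N) {s : ℂ} (hs : 0 < s.re) :
    ‖mellin (tailCharSum χ N) (-s)‖ ≤ q * ((N : ℝ) ^ (-s.re) / s.re) := by
  have hN' : (0 : ℝ) < N := by exact_mod_cast hN
  rw [mellin_tailCharSum]
  have hint : IntegrableOn (fun x : ℝ => x ^ (-s.re - 1) * q) (Set.Ioi (N : ℝ)) :=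
    (integrableOn_Ioi_rpow_of_lt (by linarith) hN').mul_const _
  refine (norm_integral_le_of_norm_le hint ?_).trans ?_
  · filter_upwards [ae_restrict_mem measurableSet_Ioi] with x hx
    rw [norm_mul, Complex.norm_cpow_eq_rpow_re_of_pos (hN'.trans hx)]
    simp only [Complex.sub_re, Complex.neg_re, Complex.one_re]
    gcongr
    · exact Real.rpow_nonneg (hN'.trans hx).le _
    · exact DirichletCharacter.norm_sum_Icc_le hχ _
  · rw [integral_mul_const, integral_Ioi_rpow_of_lt (by linarith) hN', mul_comm]
    simp only [sub_add_cancel]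
    rw [div_neg, neg_div, neg_neg]

-- Abel summation of the first N terms, subtracted from the integral representation of the whole
-- series split at N.
open MeasureTheory Filter Asymptotics in
theorem LFunction_eq_of_one_lt_re {q : ℕ} [NeZero q] {χ : DirichletCharacter ℂ q} (hq : 2 ≤ q)
    (hχ : χ ≠ 1) {N : ℕ} (hN : 1 ≤ N) {s : ℂ} (hs : 1 < s.re) :
    DirichletCharacter.LFunction χ s = ∑ k ∈ Finset.Icc 0 N, (k : ℂ) ^ (-s) * χ (k : ZMod q) -
      (N : ℂ) ^ (-s) * ∑ k ∈ Finset.Icc 0 N, χ (k : ZMod q) +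
      s * mellin (tailCharSum χ N) (-s) := by
  have hχ0 : χ ((0 : ℕ) : ZMod q) = 0 := by simpa using DirichletCharacter.apply_zero_eq_zero hq
  have hN1 : (1 : ℝ) ≤ N := by exact_mod_cast hN
  have hIcc (n : ℕ) : ∑ k ∈ Finset.Icc 1 n, χ (k : ZMod q) =
      ∑ k ∈ Finset.Icc 0 n, χ (k : ZMod q) := by
    rw [Finset.Icc_eq_cons_Ioc (Nat.zero_le n), Finset.sum_cons, hχ0, zero_add]
    rfl
  have hs0 : s ≠ 0 := by rintro rfl; simp at hs; linarith
  have hderiv (x : ℝ) (hx : 0 < x) :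
      HasDerivAt (fun y : ℝ => (y : ℂ) ^ (-s)) (-s * (x : ℂ) ^ (-s - 1)) x :=
    hasDerivAt_ofReal_cpow_const hx.ne' (by simpa using hs0)
  have hcont : ContinuousOn (fun x : ℝ => (x : ℂ) ^ (-s - 1)) (Set.Ioi 0) := fun x hx =>
    (Complex.continuousAt_ofReal_cpow_const _ _ (Or.inr (ne_of_gt hx))).continuousWithinAt
  have habel := sum_mul_eq_sub_integral_mul₀' (fun k : ℕ => χ (k : ZMod q)) hχ0 N
    (f := fun y : ℝ => (y : ℂ) ^ (-s))
    (fun x hx => (hderiv x (by linarith [hx.1])).differentiableAt) (by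
      refine IntegrableOn.congr_fun (f := fun x : ℝ => -s * (x : ℂ) ^ (-s - 1)) ?_
        (fun x hx => ((hderiv x (by linarith [hx.1])).deriv).symm) measurableSet_Icc
      refine ContinuousOn.integrableOn_Icc (continuousOn_const.mul (hcont.mono fun x hx => ?_))
      exact lt_of_lt_of_le one_pos hx.1)
  have hLS := LSeries_eq_mul_integral (fun k : ℕ => χ (k : ZMod q)) (r := 0) le_rfl
    (by linarith : (0 : ℝ) < s.re) (χ.LSeriesSummable_of_one_lt_re hs) (by
      simp only [Real.rpow_zero]
      refine IsBigO.of_bound q (.of_forall fun n => ?_)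
      rw [hIcc]
      simpa using DirichletCharacter.norm_sum_Icc_le hχ n)
  have hint : IntegrableOn (fun x : ℝ => (x : ℂ) ^ (-s - 1) *
      ∑ k ∈ Finset.Icc 0 ⌊x⌋₊, χ (k : ZMod q)) (Set.Ioi 1) := by
    refine Integrable.mul_bdd (c := q) ?_ ?_ ?_
    · exact integrableOn_Ioi_cpow_of_lt (by simp; linarith) one_pos
    · exact ((measurable_of_countable fun n : ℕ => ∑ k ∈ Finset.Icc 0 n, χ (k : ZMod q)).comp
        Nat.measurable_floor).aestronglyMeasurable
    · exact .of_forall fun x => DirichletCharacter.norm_sum_Icc_le hχ _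
  have hsplit := setIntegral_union (f := fun x : ℝ => (x : ℂ) ^ (-s - 1) *
      ∑ k ∈ Finset.Icc 0 ⌊x⌋₊, χ (k : ZMod q)) (μ := volume) (Set.Ioc_disjoint_Ioi le_rfl)
      measurableSet_Ioi (hint.mono_set Set.Ioc_subset_Ioi_self)
      (hint.mono_set (Set.Ioi_subset_Ioi hN1))
  rw [Set.Ioc_union_Ioi_eq_Ioi hN1] at hsplit
  have h1 : ∫ x in Set.Ioi (1 : ℝ), (∑ k ∈ Finset.Icc 1 ⌊x⌋₊, χ (k : ZMod q)) *
      (x : ℂ) ^ (-(s + 1)) = ∫ x in Set.Ioi (1 : ℝ), (x : ℂ) ^ (-s - 1) *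
      ∑ k ∈ Finset.Icc 0 ⌊x⌋₊, χ (k : ZMod q) := by
    congr 1 with x
    rw [hIcc, mul_comm, neg_add']
  have h2 : ∫ x in Set.Ioc (1 : ℝ) N, deriv (fun y : ℝ => (y : ℂ) ^ (-s)) x *
      ∑ k ∈ Finset.Icc 0 ⌊x⌋₊, χ (k : ZMod q) = -s * ∫ x in Set.Ioc (1 : ℝ) N,
      (x : ℂ) ^ (-s - 1) * ∑ k ∈ Finset.Icc 0 ⌊x⌋₊, χ (k : ZMod q) := by
    rw [← integral_const_mul]
    refine setIntegral_congr_fun measurableSet_Ioc fun x hx => ?_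
    rw [(hderiv x (by linarith [hx.1])).deriv, mul_assoc]
  rw [h2] at habel
  simp only [Complex.ofReal_natCast] at habel
  rw [DirichletCharacter.LFunction_eq_LSeries _ hs, hLS, h1, hsplit, habel, mellin_tailCharSum]
  ring

-- Both sides are holomorphic on the half-plane, so the identity theorem extends the formula from re
-- s > 1.
open Set in
theorem LFunction_eq_of_re_pos {q : ℕ} [NeZero q] {χ : DirichletCharacter ℂ q} (hq : 2 ≤ q)
    (hχ : χ ≠ 1) {N : ℕ} (hN : 1 ≤ N) {s : ℂ} (hs : 0 < s.re) :
    DirichletCharacter.LFunction χ s = ∑ k ∈ Finset.Icc 0 N, (k : ℂ) ^ (-s) * χ (k : ZMod q) -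
      (N : ℂ) ^ (-s) * ∑ k ∈ Finset.Icc 0 N, χ (k : ZMod q) +
      s * mellin (tailCharSum χ N) (-s) := by
  have hopen : IsOpen {z : ℂ | 0 < z.re} := isOpen_lt continuous_const Complex.continuous_re
  have hne (k : ℕ) (z : ℂ) (hz : 0 < z.re) :
      DifferentiableAt ℂ (fun z : ℂ => (k : ℂ) ^ (-z)) z := by
    refine DifferentiableAt.const_cpow differentiableAt_id.neg (Or.inr ?_)
    rw [neg_ne_zero]
    rintro h
    simp [h] at hz
  have hG : DifferentiableOn ℂ (fun s : ℂ => ∑ k ∈ Finset.Icc 0 N, (k : ℂ) ^ (-s) *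
      χ (k : ZMod q) - (N : ℂ) ^ (-s) * ∑ k ∈ Finset.Icc 0 N, χ (k : ZMod q) +
      s * mellin (tailCharSum χ N) (-s)) {z : ℂ | 0 < z.re} := by
    intro z hz
    refine DifferentiableAt.differentiableWithinAt ?_
    refine ((DifferentiableAt.fun_sum fun k _ => (hne k z hz).mul_const _).sub
      ((hne N z hz).mul_const _)).add (differentiableAt_id.mul ?_)
    have hz' : (-z).re < 0 := by simpa using hz
    exact (tailCharSum_differentiableAt_mellin hχ hN hz').comp z differentiableAt_id.neg
  refine AnalyticOnNhd.eqOn_of_preconnected_of_eventuallyEq (z₀ := 2)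
    ((DirichletCharacter.differentiable_LFunction hχ).differentiableOn.analyticOnNhd hopen)
    (hG.analyticOnNhd hopen) (convex_halfSpace_re_gt 0).isPreconnected (by simp) ?_ hs
  filter_upwards [(isOpen_lt continuous_const Complex.continuous_re).mem_nhds
    (show (2 : ℂ) ∈ {z : ℂ | 1 < z.re} by simp)] with z hz
  exact LFunction_eq_of_one_lt_re hq hχ hN hz

/-- The trivial bound for `L(s, χ)`, from partial summation after the `N`-th term. -/
theorem norm_LFunction_le {q : ℕ} [NeZero q] {χ : DirichletCharacter ℂ q} (hq : 2 ≤ q)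
    (hχ : χ ≠ 1) {N : ℕ} (hN : 1 ≤ N) {s : ℂ} (hs : 1 / 2 ≤ s.re) :
    ‖DirichletCharacter.LFunction χ s‖ ≤ 2 * √N + q * (1 + 2 * ‖s‖) / √N := by
  have hN' : (1 : ℝ) ≤ N := by exact_mod_cast hN
  have hsqrt : 0 < √(N : ℝ) := Real.sqrt_pos.2 (by linarith)
  have hs0 : 0 < s.re := by linarith
  have hpow (k : ℕ) (hk : 1 ≤ k) : ‖(k : ℂ) ^ (-s)‖ ≤ (k : ℝ) ^ (-(1 / 2) : ℝ) := by
    rw [Complex.norm_natCast_cpow_of_pos hk]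
    exact Real.rpow_le_rpow_of_exponent_le (by exact_mod_cast hk) (by simp; linarith)
  have hNpow : (N : ℝ) ^ (-(1 / 2) : ℝ) = 1 / √N := by
    rw [Real.rpow_neg (by positivity), ← Real.sqrt_eq_rpow, one_div]
  rw [LFunction_eq_of_re_pos hq hχ hN hs0]
  have h1 : ‖∑ k ∈ Finset.Icc 0 N, (k : ℂ) ^ (-s) * χ (k : ZMod q)‖ ≤ 2 * √N := by
    rw [Finset.Icc_eq_cons_Ioc (Nat.zero_le N), Finset.sum_cons]
    have : χ ((0 : ℕ) : ZMod q) = 0 := by simpa using DirichletCharacter.apply_zero_eq_zero hq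
    rw [this, mul_zero, zero_add]
    refine (norm_sum_le _ _).trans (le_trans ?_ (sum_Icc_rpow_neg_half_le N))
    refine Finset.sum_le_sum fun k hk => ?_
    rw [norm_mul]
    refine (mul_le_of_le_one_right (norm_nonneg _) (χ.norm_le_one _)).trans (hpow k ?_)
    exact (Finset.mem_Ioc.1 hk).1
  have h2 : ‖(N : ℂ) ^ (-s) * ∑ k ∈ Finset.Icc 0 N, χ (k : ZMod q)‖ ≤ 1 / √N * q := by
    rw [norm_mul, ← hNpow]
    gcongr
    · exact hpow N hN
    · exact DirichletCharacter.norm_sum_Icc_le hχ N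
  have h3 : ‖s * mellin (tailCharSum χ N) (-s)‖ ≤ ‖s‖ * (q * (1 / √N / (1 / 2))) := by
    rw [norm_mul, ← hNpow]
    gcongr
    refine (norm_mellin_tailCharSum_le hχ hN hs0).trans ?_
    gcongr
  calc _ ≤ 2 * √N + 1 / √N * q + ‖s‖ * (q * (1 / √N / (1 / 2))) :=
        (norm_add_le _ _).trans (add_le_add ((norm_sub_le _ _).trans (add_le_add h1 h2)) h3)
    _ = _ := by field_simp; ring

/-! ### The Euler product logarithm for re s > 1 -/

open ArithmeticFunction in
theorem eulerLog_eq_LSeries {q : ℕ} (χ : DirichletCharacter ℂ q) {s : ℂ} (hs : 1 < s.re) :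
    eulerLog χ s = LSeries (fun n ↦ χ n * vonMangoldt n / Real.log n) s :=
  χ.eulerProduct_log_eq_LSeries hs

open ArithmeticFunction in
theorem norm_vonMangoldt_div_log_le {q : ℕ} (χ : DirichletCharacter ℂ q) (n : ℕ) :
    ‖χ n * (vonMangoldt n : ℂ) / (Real.log n : ℂ)‖ ≤ vonMangoldt n / Real.log n := by
  have hlog : 0 ≤ Real.log n := Real.log_natCast_nonneg n
  rw [norm_div, norm_mul, Complex.norm_real, Complex.norm_real, Real.norm_of_nonneg hlog,
    Real.norm_of_nonneg vonMangoldt_nonneg]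
  gcongr
  exact mul_le_of_le_one_left vonMangoldt_nonneg (χ.norm_le_one _)

open ArithmeticFunction in
theorem differentiableOn_eulerLog {q : ℕ} (χ : DirichletCharacter ℂ q) :
    DifferentiableOn ℂ (eulerLog χ) {s | 1 < s.re} := by
  refine DifferentiableOn.congr (f := LSeries (fun n ↦ χ n * vonMangoldt n / Real.log n)) ?_
    fun s hs => eulerLog_eq_LSeries χ hs
  refine (LSeries_differentiableOn _).mono fun s hs => ?_
  refine (LSeries.abscissaOfAbsConv_le_of_le_const ⟨1, fun n _ => ?_⟩).trans_lt
    (by exact_mod_cast hs)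
  exact (norm_vonMangoldt_div_log_le χ n).trans
    (div_le_one_of_le₀ vonMangoldt_le_log (Real.log_natCast_nonneg n))

theorem exp_eulerLog {q : ℕ} [NeZero q] (χ : DirichletCharacter ℂ q) {s : ℂ} (hs : 1 < s.re) :
    Complex.exp (eulerLog χ s) = DirichletCharacter.LFunction χ s := by
  rw [eulerLog, χ.LSeries_eulerProduct_exp_log hs, χ.LFunction_eq_LSeries hs]

theorem riemannZeta_ofReal_re {σ : ℝ} (hσ : 1 < σ) :
    (riemannZeta σ).re = ∑' n : ℕ, 1 / ((n : ℝ) + 1) ^ σ := by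
  rw [zeta_eq_tsum_one_div_nat_add_one_cpow (by simpa using hσ),
    ← Complex.ofReal_re (∑' n : ℕ, 1 / ((n : ℝ) + 1) ^ σ)]
  congr 1
  push_cast
  congr 1 with n
  rw [Complex.ofReal_cpow (by positivity)]
  simp

theorem riemannZeta_ofReal_re_le {σ : ℝ} (hσ : 1 < σ) :
    (riemannZeta σ).re ≤ σ / (σ - 1) := by
  have h := ZetaAsymptotics.zeta_limit_aux1 hσ
  have h0 : 0 ≤ ZetaAsymptotics.termTSum σ :=
    tsum_nonneg fun n => ZetaAsymptotics.term_nonneg _ _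
  have : σ / (σ - 1) = 1 + 1 / (σ - 1) := by field_simp [(sub_pos.2 hσ).ne']; ring
  rw [riemannZeta_ofReal_re hσ, this]
  have : 0 ≤ σ * ZetaAsymptotics.termTSum σ := by positivity
  linarith

-- Termwise comparison with the Dirichlet series of log ζ at the real point re s, followed by ζ(σ) ≤
-- σ/(σ - 1).
open ArithmeticFunction in
theorem norm_eulerLog_le {q : ℕ} (χ : DirichletCharacter ℂ q) {s : ℂ} (hs : 1 < s.re) :
    ‖eulerLog χ s‖ ≤ Real.log (s.re / (s.re - 1)) := by
  have hsum : Summable fun n : ℕ => vonMangoldt n / ((n : ℝ) ^ s.re * Real.log n) := by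
    refine Summable.of_nonneg_of_le (fun n => ?_) (fun n => ?_) (Real.summable_nat_rpow_inv.2 hs)
    · have := Real.log_natCast_nonneg n
      have := vonMangoldt_nonneg (n := n)
      positivity
    · rw [mul_comm, ← div_div, div_eq_mul_inv]
      exact mul_le_of_le_one_left (by positivity)
        (div_le_one_of_le₀ vonMangoldt_le_log (Real.log_natCast_nonneg n))
  have h0 : 0 < (riemannZeta s.re).re := by
    rw [riemannZeta_ofReal_re hs]
    have h1 : Summable fun n : ℕ => 1 / ((n : ℝ) + 1) ^ s.re := by
      exact_mod_cast (summable_nat_add_iff 1).2 (Real.summable_one_div_nat_rpow.2 hs)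
    exact h1.tsum_pos (fun n => by positivity) 0 (by simp)
  rw [eulerLog_eq_LSeries χ hs]
  refine le_trans ?_ (Real.log_le_log h0 (riemannZeta_ofReal_re_le hs))
  rw [log_riemannZeta_eq hs]
  refine tsum_of_norm_bounded hsum.hasSum fun n => ?_
  rcases eq_or_ne n 0 with rfl | hn
  · simp
  rw [LSeries.term_of_ne_zero hn, norm_div, Complex.norm_natCast_cpow_of_pos (by omega),
    mul_comm ((n : ℝ) ^ s.re), ← div_div]
  exact div_le_div_of_nonneg_right (norm_vonMangoldt_div_log_le χ n) (by positivity)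

/-! ### The holomorphic logarithm on a zero-free half-strip -/

/-- The open half-strip `{z : re z > 1/2, |im z - t| < W}`. -/
def halfStrip (t W : ℝ) : Set ℂ := {z | 1 / 2 < z.re ∧ |z.im - t| < W}

theorem isOpen_halfStrip (t W : ℝ) : IsOpen (halfStrip t W) :=
  (isOpen_lt continuous_const Complex.continuous_re).inter
    (isOpen_lt (Complex.continuous_im.sub continuous_const).abs continuous_const)

theorem convex_halfStrip (t W : ℝ) : Convex ℝ (halfStrip t W) := by
  have : halfStrip t W = {z : ℂ | 1 / 2 < z.re} ∩
      ({z : ℂ | t - W < z.im} ∩ {z : ℂ | z.im < t + W}) := by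
    ext z
    simp only [halfStrip, abs_lt, Set.mem_ofPred_eq, Set.mem_inter_iff]
    constructor <;> rintro ⟨h1, h2, h3⟩ <;> refine ⟨h1, ?_, ?_⟩ <;> linarith
  rw [this]
  exact (convex_halfSpace_re_gt _).inter
    ((convex_halfSpace_im_gt _).inter (convex_halfSpace_im_lt _))

/-- f is a primitive of L'/L normalised at 2 + it. Then L·exp(-f) and, for re z > 1, f minus the
Euler logarithm have zero derivative on connected open sets. The fundamental theorem of calculus on
horizontal segments identifies f with `dirichletLog`. -/
theorem exists_logarithm_LFunction {q : ℕ} [NeZero q] {χ : DirichletCharacter ℂ q} (hχ : χ ≠ 1)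
    {t W : ℝ} (hW : 0 < W) (h : ∀ z ∈ halfStrip t W, DirichletCharacter.LFunction χ z ≠ 0) :
    ∃ f : ℂ → ℂ, (∀ z ∈ halfStrip t W, HasDerivAt f (dirichletLogDeriv χ z) z) ∧
      (∀ z ∈ halfStrip t W, Complex.exp (f z) = DirichletCharacter.LFunction χ z) ∧
      (∀ z ∈ halfStrip t W, 1 < z.re → f z = eulerLog χ z) ∧
      ∀ z ∈ halfStrip t W, f z = dirichletLog χ z := by
  have hU := isOpen_halfStrip t W
  have hL := DirichletCharacter.differentiable_LFunction hχ
  have hdiff : DifferentiableOn ℂ (dirichletLogDeriv χ) (halfStrip t W) :=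
    (hL.deriv.differentiableOn).div hL.differentiableOn h
  obtain ⟨g, hg⟩ := (convex_halfStrip t W).exists_forall_hasDerivWithinAt hdiff
  set z₀ : ℂ := 2 + t * Complex.I
  have hz₀ : z₀ ∈ halfStrip t W := by
    refine ⟨?_, ?_⟩
    · simp [z₀]; norm_num
    · simpa [z₀] using hW
  have hz₀' : 1 < z₀.re := by simp [z₀]
  set f : ℂ → ℂ := fun z => g z - g z₀ + eulerLog χ z₀
  have hf : ∀ z ∈ halfStrip t W, HasDerivAt f (dirichletLogDeriv χ z) z := fun z hz =>
    (((hg z hz).hasDerivAt (hU.mem_nhds hz)).sub_const _).add_const _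
  have hfz₀ : f z₀ = eulerLog χ z₀ := by simp [f]
  have hexp : ∀ z ∈ halfStrip t W, Complex.exp (f z) = DirichletCharacter.LFunction χ z := by
    intro z hz
    have hd : ∀ w ∈ halfStrip t W, HasDerivAt
        (fun w => DirichletCharacter.LFunction χ w * Complex.exp (-f w)) 0 w := fun w hw => by
      have := (hL w).hasDerivAt.mul (hf w hw).neg.cexp
      convert! this using 1
      have := h w hw
      simp only [dirichletLogDeriv]
      field_simp
      ring
    have hc := hU.is_const_of_deriv_eq_zero (convex_halfStrip t W).isPreconnected
      (fun w hw => (hd w hw).differentiableAt.differentiableWithinAt)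
      (fun w hw => (hd w hw).deriv) hz hz₀
    simp only [hfz₀, Complex.exp_neg, exp_eulerLog χ hz₀'] at hc
    rw [mul_inv_cancel₀ (h z₀ hz₀), mul_inv_eq_one₀ (Complex.exp_ne_zero _)] at hc
    exact hc.symm
  have heul : ∀ z ∈ halfStrip t W, 1 < z.re → f z = eulerLog χ z := by
    intro z hz hz1
    set V := halfStrip t W ∩ {z : ℂ | 1 < z.re}
    have hV : IsOpen V := hU.inter (isOpen_lt continuous_const Complex.continuous_re)
    have hd : ∀ w ∈ V, HasDerivAt (fun w => f w - eulerLog χ w) 0 w := fun w hw => by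
      have hE : HasDerivAt (eulerLog χ) (deriv (eulerLog χ) w) w :=
        ((differentiableOn_eulerLog χ).differentiableAt
          ((isOpen_lt continuous_const Complex.continuous_re).mem_nhds hw.2)).hasDerivAt
      have h1 : HasDerivAt (DirichletCharacter.LFunction χ)
          (Complex.exp (eulerLog χ w) * deriv (eulerLog χ) w) w := by
        refine hE.cexp.congr_of_eventuallyEq ?_
        filter_upwards [(isOpen_lt continuous_const Complex.continuous_re).mem_nhds hw.2] with y hy
        exact (exp_eulerLog χ hy).symm
      have h2 : dirichletLogDeriv χ w = deriv (eulerLog χ) w := by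
        rw [dirichletLogDeriv, h1.deriv, exp_eulerLog χ hw.2, mul_div_cancel_left₀ _ (h w hw.1)]
      have h3 := (hf w hw.1).sub hE
      rw [h2, sub_self] at h3
      exact h3
    have hc := hV.is_const_of_deriv_eq_zero
      ((convex_halfStrip t W).inter (convex_halfSpace_re_gt 1)).isPreconnected
      (fun w hw => (hd w hw).differentiableAt.differentiableWithinAt)
      (fun w hw => (hd w hw).deriv) ⟨hz, hz1⟩ ⟨hz₀, hz₀'⟩
    simp only [hfz₀, sub_self] at hc
    exact sub_eq_zero.1 hc
  refine ⟨f, hf, hexp, heul, fun z hz => ?_⟩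
  have hline : ∀ u ∈ Set.uIcc 2 z.re, (u + z.im * Complex.I : ℂ) ∈ halfStrip t W := fun u hu => by
    refine ⟨?_, by simpa using hz.2⟩
    have := hz.1
    have h2 : min 2 z.re ≤ u := hu.1
    have : 1 / 2 < min 2 z.re := lt_min (by norm_num) this
    simp
    linarith
  have h2 := hline 2 Set.left_mem_uIcc
  have hFTC := intervalIntegral.integral_eq_sub_of_hasDerivAt (a := 2) (b := z.re)
    (f := fun u : ℝ => f (u + z.im * Complex.I))
    (f' := fun u : ℝ => dirichletLogDeriv χ (u + z.im * Complex.I)) (fun u hu => by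
      have := (hf _ (hline u hu)).comp_add_const (u : ℂ) (z.im * Complex.I)
      exact this.comp_ofReal) (by
      refine ContinuousOn.intervalIntegrable ?_
      exact hdiff.continuousOn.comp (by fun_prop) hline)
  rw [dirichletLog, hFTC, Complex.re_add_im, ← heul _ (by simpa using h2) (by simp)]
  simp

/-! ### Three-lines interpolation on a finite rectangle -/

open Complex in
/-- A three-lines theorem on a rectangle: the Gaussian weight with parameter `η` makes the bound on
the horizontal sides harmless as soon as the rectangle is tall enough. -/
theorem norm_le_of_rectangle {F : ℂ → ℂ} {x₀ x₁ t H M lam η : ℝ} (hx : x₀ < x₁) (hH : 0 < H)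
    (hM : 0 ≤ M) (hlam : 0 ≤ lam) (hη : 0 ≤ η) (hle : lam * (x₁ - x₀) ≤ η * H ^ 2)
    (hF : ∀ z : ℂ, x₀ ≤ z.re → z.re ≤ x₁ → |z.im - t| ≤ H → DifferentiableAt ℂ F z)
    (hall : ∀ z : ℂ, x₀ ≤ z.re → z.re ≤ x₁ → |z.im - t| ≤ H →
      ‖F z‖ ≤ M * Real.exp (lam * (x₁ - x₀)))
    (hright : ∀ z : ℂ, z.re = x₁ → |z.im - t| ≤ H → ‖F z‖ ≤ M)
    {σ : ℝ} (h₀ : x₀ ≤ σ) (h₁ : σ ≤ x₁) :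
    ‖F (σ + t * I)‖ ≤ M * Real.exp (lam * (x₁ - σ) + η * (x₁ - x₀) ^ 2) := by
  set U : Set ℂ := Set.Ioo x₀ x₁ ×ℂ Set.Ioo (t - H) (t + H)
  have hcl : closure U = Set.Icc x₀ x₁ ×ℂ Set.Icc (t - H) (t + H) := by
    rw [closure_reProdIm, closure_Ioo hx.ne, closure_Ioo (by linarith)]
  have hmem : ∀ z ∈ closure U, x₀ ≤ z.re ∧ z.re ≤ x₁ ∧ |z.im - t| ≤ H := fun z hz => by
    rw [hcl, mem_reProdIm] at hz
    exact ⟨hz.1.1, hz.1.2, abs_le.2 ⟨by linarith [hz.2.1], by linarith [hz.2.2]⟩⟩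
  -- The linear term equalises the bounds on the two vertical sides. The Gaussian is centred at the
  -- target point, where it equals 1, and has decay exp(-η H²) on the horizontal sides.
  set w : ℂ → ℂ := fun z => exp (η * (z - (σ + t * I)) ^ 2 + lam * (z - x₁))
  have hw (z : ℂ) : ‖w z‖ =
      Real.exp (η * ((z.re - σ) ^ 2 - (z.im - t) ^ 2) + lam * (z.re - x₁)) := by
    rw [norm_exp]
    congr 1
    simp [pow_two]
  have hd : DiffContOnCl ℂ (fun z => F z * w z) U := by
    refine DifferentiableOn.diffContOnCl fun z hz => ?_
    obtain ⟨a, b, c⟩ := hmem z hz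
    refine ((hF z a b c).mul ?_).differentiableWithinAt
    fun_prop
  have hbd : Bornology.IsBounded U :=
    (Metric.isBounded_Ioo _ _).reProdIm (Metric.isBounded_Ioo _ _)
  have hsq (z : ℂ) (a : x₀ ≤ z.re) (b : z.re ≤ x₁) : (z.re - σ) ^ 2 ≤ (x₁ - x₀) ^ 2 :=
    sq_le_sq' (by linarith) (by linarith)
  have hfr : ∀ z ∈ frontier U, ‖F z * w z‖ ≤ M * Real.exp (η * (x₁ - x₀) ^ 2) := by
    intro z hz
    obtain ⟨a, b, c⟩ := hmem z (frontier_subset_closure hz)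
    have hs := mul_le_mul_of_nonneg_left (hsq z a b) hη
    have h0 := mul_nonneg hη (sq_nonneg (z.im - t))
    rw [norm_mul, hw]
    by_cases h1 : z.re = x₁
    · refine mul_le_mul (hright z h1 c) (Real.exp_le_exp.2 ?_) (Real.exp_pos _).le hM
      rw [h1] at hs ⊢
      linarith
    · refine (mul_le_mul_of_nonneg_right (hall z a b c) (Real.exp_pos _).le).trans ?_
      rw [mul_assoc, ← Real.exp_add]
      refine mul_le_mul_of_nonneg_left (Real.exp_le_exp.2 ?_) hM
      by_cases h2 : z.re = x₀
      · rw [h2] at hs ⊢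
        linarith
      -- Off the vertical sides a frontier point is on a horizontal one, where `hle` lets the
      -- Gaussian absorb the excess exp(lam (x₁ - x₀)).
      · have hH' : (z.im - t) ^ 2 = H ^ 2 := by
          have hzU : z ∉ U := by
            have : IsOpen U := isOpen_Ioo.reProdIm isOpen_Ioo
            rw [this.frontier_eq] at hz
            exact hz.2
          rw [← sq_abs]
          congr 1
          by_contra h3
          refine hzU (mem_reProdIm.2 ⟨⟨lt_of_le_of_ne a (Ne.symm h2), lt_of_le_of_ne b h1⟩, ?_⟩)
          have := abs_lt.1 (lt_of_le_of_ne c h3)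
          exact ⟨by linarith [this.1], by linarith [this.2]⟩
        rw [hH']
        have : lam * (z.re - x₁) ≤ 0 := mul_nonpos_of_nonneg_of_nonpos hlam (by linarith)
        linarith
  have hz : (σ + t * I : ℂ) ∈ closure U := by
    rw [hcl, mem_reProdIm]
    simp [h₀, h₁, hH.le]
  have key := norm_le_of_forall_mem_frontier_norm_le hbd hd hfr hz
  rw [norm_mul, hw] at key
  have : Real.exp (lam * (x₁ - σ) + η * (x₁ - x₀) ^ 2) =
      Real.exp (η * (x₁ - x₀) ^ 2) / Real.exp (lam * (σ - x₁)) := by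
    rw [← Real.exp_sub]
    ring_nf
  rw [this, ← mul_div_assoc, le_div_iff₀ (Real.exp_pos _)]
  simpa using key

-- The slope 2l spends the factor e^l over width 1/2. With H = 5l and η = 0.04, η H² = l² ≥ l, while
-- the weight costs only exp(η/4) = exp(0.01). The shift of both edges by B/l costs e^(2B).
open Complex in
theorem norm_le_of_strip {F : ℂ → ℂ} {t B l M : ℝ} (hl : 1 ≤ l) (hM : 0 ≤ M)
    (hF : ∀ z : ℂ, 1 / 2 + B / l ≤ z.re → |z.im - t| ≤ 5 * l → DifferentiableAt ℂ F z)
    (hall : ∀ z : ℂ, 1 / 2 + B / l ≤ z.re → |z.im - t| ≤ 5 * l → ‖F z‖ ≤ M * Real.exp l)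
    (hright : ∀ z : ℂ, 1 + B / l ≤ z.re → |z.im - t| ≤ 5 * l → ‖F z‖ ≤ M)
    {σ : ℝ} (h₀ : 1 / 2 + B / l ≤ σ) (h₁ : σ ≤ 1 + B / l) :
    ‖F (σ + t * I)‖ ≤ M * Real.exp (2 * B + 0.01) * Real.exp l ^ (2 * (1 - σ)) := by
  have hd : 1 + B / l - (1 / 2 + B / l) = 1 / 2 := by ring
  have h := norm_le_of_rectangle (F := F) (x₀ := 1 / 2 + B / l) (x₁ := 1 + B / l) (t := t)
    (H := 5 * l) (M := M) (lam := 2 * l) (η := 0.04) (by linarith) (by linarith) hM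
    (by linarith) (by norm_num) (by rw [hd]; nlinarith) (fun z a _ c => hF z a c)
    (fun z a _ c => by rw [hd, mul_assoc, mul_comm l, ← mul_assoc]; simpa using hall z a c)
    (fun z a c => hright z a.ge c) h₀ h₁
  rw [← Real.exp_mul, mul_assoc, ← Real.exp_add]
  convert h using 3
  rw [hd]
  field_simp
  ring

/-! ### Explicit numerical estimates -/

/-- Numerical values of the exponential function. -/
theorem exp_bounds : Real.exp 9 ≤ 20000 ∧ Real.exp 2 ≤ 9 ∧ 11 ≤ Real.exp (5 / 2) ∧
    4.23 ≤ Real.exp (3 / 2) ∧ Real.exp (2 * 0.5 + 0.01) ≤ 2.75 ∧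
    Real.exp (2 * 1.0051 + 0.01) ≤ 7.6 := by
  have h1 := Real.exp_one_gt_d9
  have h2 := Real.exp_one_lt_d9
  have hn (n : ℕ) : Real.exp n = Real.exp 1 ^ n := by rw [← Real.exp_nat_mul, mul_one]
  have hub (x : ℝ) (hx : x < 1) : Real.exp x ≤ 1 / (1 - x) := by
    have := Real.one_sub_le_exp_neg x
    rw [← neg_neg x, Real.exp_neg, one_div, neg_neg]
    exact inv_anti₀ (by linarith) this
  refine ⟨?_, ?_, ?_, ?_, ?_, ?_⟩
  · calc Real.exp 9 = Real.exp 1 ^ 9 := by exact_mod_cast hn 9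
      _ ≤ 2.72 ^ 9 := by gcongr; linarith
      _ ≤ _ := by norm_num
  · calc Real.exp 2 = Real.exp 1 ^ 2 := by exact_mod_cast hn 2
      _ ≤ 2.72 ^ 2 := by gcongr; linarith
      _ ≤ _ := by norm_num
  · refine (pow_le_pow_iff_left₀ (by norm_num) (Real.exp_pos _).le two_ne_zero).1 ?_
    calc (11 : ℝ) ^ 2 ≤ 2.7 ^ 5 := by norm_num
      _ ≤ Real.exp 1 ^ 5 := by gcongr; linarith
      _ = _ := by rw [← Real.exp_nat_mul, ← Real.exp_nat_mul]; norm_num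
  · refine (pow_le_pow_iff_left₀ (by norm_num) (Real.exp_pos _).le two_ne_zero).1 ?_
    calc (4.23 : ℝ) ^ 2 ≤ 2.7 ^ 3 := by norm_num
      _ ≤ Real.exp 1 ^ 3 := by gcongr; linarith
      _ = _ := by rw [← Real.exp_nat_mul, ← Real.exp_nat_mul]; norm_num
  · calc Real.exp (2 * 0.5 + 0.01) = Real.exp 1 * Real.exp 0.01 := by
          rw [← Real.exp_add]; norm_num
      _ ≤ 2.72 * (1 / (1 - 0.01)) := by gcongr; linarith; exact hub _ (by norm_num)
      _ ≤ _ := by norm_num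
  · calc Real.exp (2 * 1.0051 + 0.01) = Real.exp 1 ^ 2 * Real.exp 0.0202 := by
          rw [← Real.exp_nat_mul, ← Real.exp_add]; norm_num
      _ ≤ 2.72 ^ 2 * (1 / (1 - 0.0202)) := by gcongr; linarith; exact hub _ (by norm_num)
      _ ≤ _ := by norm_num

-- The length N = ⌈qT⌉ balances the two terms of the trivial bound; the constants add up to 2·1.01 +
-- 2.21 = 4.23 ≤ e^(3/2).
open Real in
theorem log_norm_LFunction_le {q : ℕ} [NeZero q] {χ : DirichletCharacter ℂ q} (hq : 2 ≤ q)
    (hχ : χ ≠ 1) {T : ℝ} (hT : 10 ^ 4 ≤ T) {s : ℂ} (hs : 1 / 2 ≤ s.re) (hsT : ‖s‖ ≤ 1.1 * T)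
    (h0 : DirichletCharacter.LFunction χ s ≠ 0) :
    log ‖DirichletCharacter.LFunction χ s‖ ≤ log (q * T) / 2 + 3 / 2 := by
  have hq' : (2 : ℝ) ≤ q := by exact_mod_cast hq
  set x : ℝ := q * T
  have hx : 20000 ≤ x := by
    calc (20000 : ℝ) = 2 * 10 ^ 4 := by norm_num
      _ ≤ q * T := by gcongr
  have hx0 : 0 < √x := sqrt_pos.2 (by linarith)
  have hNx : x ≤ ⌈x⌉₊ := Nat.le_ceil x
  have hNx' : (⌈x⌉₊ : ℝ) < x + 1 := Nat.ceil_lt_add_one (by linarith)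
  have hN : 1 ≤ ⌈x⌉₊ := Nat.one_le_ceil_iff.2 (by linarith)
  have h1 : √(⌈x⌉₊ : ℝ) ≤ 1.01 * √x := by
    rw [sqrt_le_iff]
    refine ⟨by positivity, ?_⟩
    rw [mul_pow, sq_sqrt (by linarith)]
    linarith
  have h2 : (q : ℝ) * (1 + 2 * ‖s‖) / √(⌈x⌉₊ : ℝ) ≤ 2.21 * √x := by
    calc (q : ℝ) * (1 + 2 * ‖s‖) / √(⌈x⌉₊ : ℝ) ≤ q * (2.21 * T) / √x := by
          gcongr
          linarith
      _ = 2.21 * (x / √x) := by simp only [x]; ring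
      _ = 2.21 * √x := by rw [div_sqrt]
  have h3 := norm_LFunction_le hq hχ hN hs
  calc log ‖DirichletCharacter.LFunction χ s‖ ≤ log (√x * exp (3 / 2)) := by
        refine log_le_log (norm_pos_iff.2 h0) ?_
        nlinarith [exp_bounds.2.2.2.1]
    _ = _ := by rw [log_mul hx0.ne' (exp_pos _).ne', log_exp, log_sqrt (by linarith)]

theorem log_log_estimates {q : ℕ} {T : ℝ} (hq : 2 ≤ q)
    (hT : 10450 + 10 ^ 3 * Real.log (Real.log q) ≤ T) :
    10 ^ 4 ≤ T ∧ 9 ≤ Real.log (q * T) ∧ 2 ≤ Real.log (Real.log (q * T)) ∧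
      5 * Real.log (Real.log (q * T)) + 4 ≤ 0.1 * T ∧
      Real.log (Real.log (q * T)) ≤ Real.log (Real.log (q * (T + 1))) := by
  have hq' : (2 : ℝ) ≤ q := by exact_mod_cast hq
  have hlogq : 0.69 ≤ Real.log q := by
    have := Real.log_two_gt_d9
    have := Real.log_le_log two_pos hq'
    linarith
  -- For q = 2 the double logarithm is negative; it is at least 1 - 1/0.69 > -0.45, which explains
  -- 10450 in place of 10^4.
  have hT4 : 10 ^ 4 ≤ T := by
    have := Real.one_sub_inv_le_log_of_pos (x := Real.log q) (by linarith)
    have h2 : (Real.log q)⁻¹ ≤ (0.69 : ℝ)⁻¹ := inv_anti₀ (by norm_num) hlogq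
    norm_num at h2 hT ⊢
    linarith
  have hx : 20000 ≤ q * T := by
    calc (20000 : ℝ) = 2 * 10 ^ 4 := by norm_num
      _ ≤ q * T := by gcongr
  have hL : 9 ≤ Real.log (q * T) := by
    rw [Real.le_log_iff_exp_le (by linarith)]
    exact exp_bounds.1.trans hx
  refine ⟨hT4, hL, ?_, ?_, ?_⟩
  · rw [Real.le_log_iff_exp_le (by linarith)]
    exact exp_bounds.2.1.trans hL
  · have hadd : Real.log (q * T) = Real.log q + Real.log T :=
      Real.log_mul (by linarith) (by linarith)
    -- If T dominates, log log(qT) is O(log T); if q dominates, it exceeds log log q by at most log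
    -- 2, and the hypothesis on T applies.
    rcases le_total (Real.log q) (Real.log T) with h | h
    · have h1 : Real.log T ≤ T / 10 ^ 4 + 9 := by
        have h2 := Real.log_le_sub_one_of_pos (x := T / 10 ^ 4) (by linarith)
        have h3 : Real.log (10 ^ 4) ≤ 10 := by
          rw [Real.log_le_iff_le_exp (by norm_num)]
          calc (10 : ℝ) ^ 4 ≤ 2.7 ^ 10 := by norm_num
            _ ≤ Real.exp 1 ^ 10 := by gcongr; linarith [Real.exp_one_gt_d9]
            _ = _ := by rw [← Real.exp_nat_mul]; norm_num
        rw [Real.log_div (by linarith) (by norm_num)] at h2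
        norm_num at *
        linarith
      have h4 := Real.log_le_sub_one_of_pos (x := Real.log (q * T)) (by linarith)
      norm_num at *
      linarith
    · have h1 : Real.log (Real.log (q * T)) ≤ Real.log 2 + Real.log (Real.log q) := by
        rw [← Real.log_mul (by norm_num) (by linarith)]
        exact Real.log_le_log (by linarith) (by linarith)
      have := Real.log_two_lt_d9
      norm_num at *
      linarith
  · refine Real.log_le_log (by linarith) (Real.log_le_log (by linarith) ?_)
    nlinarith

/-! ### Bounds for the logarithm and for L'/L -/

/-- `f` is a logarithm of `L(·, χ)` on a tall half-strip around height `t`. -/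
structure IsLogOnStrip {q : ℕ} [NeZero q] (χ : DirichletCharacter ℂ q) (t l W : ℝ) (f : ℂ → ℂ) :
    Prop where
  level : 2 ≤ q
  ne_one : χ ≠ 1
  height : 10 ^ 4 ≤ |t|
  loglog : Real.log (q * |t|) = Real.exp l
  two_le : 2 ≤ l
  nine_le : 9 ≤ Real.exp l
  narrow : 5 * l + 4 ≤ 0.1 * |t|
  wide : 5 * l + 2 ≤ W
  hasDerivAt : ∀ z ∈ halfStrip t W, HasDerivAt f (dirichletLogDeriv χ z) z
  exp_eq : ∀ z ∈ halfStrip t W, Complex.exp (f z) = DirichletCharacter.LFunction χ z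
  eq_eulerLog : ∀ z ∈ halfStrip t W, 1 < z.re → f z = eulerLog χ z

namespace IsLogOnStrip

variable {q : ℕ} [NeZero q] {χ : DirichletCharacter ℂ q} {t l W : ℝ} {f : ℂ → ℂ}

/-- Here ζ(re z) ≤ 1 + 2l. The constant 1.85 is shared with `norm_le`, since the interpolation takes
the same M on both sides. -/
theorem norm_le_right (h : IsLogOnStrip χ t l W f) {z : ℂ} (hz : 1 + 0.5 / l ≤ z.re)
    (hzt : |z.im - t| ≤ 5 * l + 1) : ‖f z‖ ≤ 1.85 * l := by
  have hl := h.two_le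
  have hpos : 0 < 0.5 / l := by positivity
  rw [h.eq_eulerLog z ⟨by linarith, by linarith [h.wide]⟩ (by linarith)]
  refine (norm_eulerLog_le χ (by linarith)).trans ?_
  rw [Real.log_le_iff_le_exp (div_pos (by linarith) (by linarith))]
  have h1 := Real.quadratic_le_exp_of_nonneg (x := 1.85 * l) (by linarith)
  have h2 : 1 / (z.re - 1) ≤ 2 * l := by
    rw [div_le_iff₀ (by linarith)]
    have : 2 * l * (0.5 / l) = 1 := by field_simp; norm_num
    nlinarith
  have h3 : z.re / (z.re - 1) = 1 + 1 / (z.re - 1) := by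
    field_simp [(by linarith : z.re - 1 ≠ 0)]
    ring
  rw [h3]
  nlinarith

theorem norm_le_of_re_ge (h : IsLogOnStrip χ t l W f) {z : ℂ} (hz : 1.1 ≤ z.re)
    (hzt : |z.im - t| ≤ 5 * l + 1) : ‖f z‖ ≤ 5 / 2 := by
  rw [h.eq_eulerLog z ⟨by linarith, by linarith [h.wide]⟩ (by linarith)]
  refine (norm_eulerLog_le χ (by linarith)).trans ?_
  rw [Real.log_le_iff_le_exp (div_pos (by linarith) (by linarith))]
  refine le_trans ?_ exp_bounds.2.2.1
  rw [div_le_iff₀ (by linarith)]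
  linarith

theorem re_le (h : IsLogOnStrip χ t l W f) {z : ℂ} (hz : 1 / 2 < z.re) (hz2 : z.re < 1.7)
    (hzt : |z.im - t| < 5 * l + 1.6) : (f z).re ≤ Real.exp l / 2 + 3 / 2 := by
  have hmem : z ∈ halfStrip t W := ⟨hz, by linarith [h.wide]⟩
  have he := h.exp_eq z hmem
  have hlog : (f z).re = Real.log ‖DirichletCharacter.LFunction χ z‖ := by
    rw [← he, Complex.norm_exp, Real.log_exp]
  rw [hlog, ← h.loglog]
  refine log_norm_LFunction_le h.level h.ne_one h.height hz.le ?_ (he ▸ Complex.exp_ne_zero _)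
  have h1 := Complex.norm_le_abs_re_add_abs_im z
  rw [abs_of_pos (by linarith : 0 < z.re)] at h1
  have h2 : |z.im| ≤ |z.im - t| + |t| := by simpa using abs_add_le (z.im - t) t
  linarith [h.narrow]

/-- Borel–Carathéodory on the disc of radius 0.6 about 1.1 + i im z, which is tangent to the line re
= 1/2. The point z keeps distance at least 0.5/l from the circle, which costs a factor 2l. -/
theorem norm_le (h : IsLogOnStrip χ t l W f) {z : ℂ} (hz : 1 / 2 + 0.5 / l ≤ z.re)
    (hzt : |z.im - t| ≤ 5 * l + 1) : ‖f z‖ ≤ 1.85 * l * Real.exp l := by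
  have hl := h.two_le
  have hL := h.nine_le
  rcases le_or_gt 1.1 z.re with hre | hre
  · exact (h.norm_le_of_re_ge hre hzt).trans (by nlinarith)
  set c : ℂ := 1.1 + z.im * Complex.I
  have hcre : c.re = 1.1 := by simp [c]
  have hcim : c.im = z.im := by simp [c]
  have hball (w : ℂ) (hw : w ∈ Metric.ball (0 : ℂ) 0.6) : 1 / 2 < (c + w).re ∧
      (c + w).re < 1.7 ∧ |(c + w).im - t| < 5 * l + 1.6 := by
    rw [mem_ball_zero_iff] at hw
    have h1 := abs_le.1 ((Complex.abs_re_le_norm w).trans hw.le)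
    have h1' := abs_lt.1 ((Complex.abs_re_le_norm w).trans_lt hw)
    have h2 := (Complex.abs_im_le_norm w).trans_lt hw
    rw [Complex.add_re, Complex.add_im, hcre, hcim]
    refine ⟨by linarith [h1'.1], by linarith [h1'.2], ?_⟩
    have : z.im + w.im - t = (z.im - t) + w.im := by ring
    rw [this]
    exact (abs_add_le _ _).trans_lt (by linarith)
  set r : ℝ := 1.1 - z.re
  have hd : 0.5 / l ≤ 0.6 - r := by simp only [r]; linarith
  have hdpos : 0 < 0.6 - r := lt_of_lt_of_le (by positivity) hd
  have hw : ‖z - c‖ = r := by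
    have : z - c = ((z.re - 1.1 : ℝ) : ℂ) := by
      apply Complex.ext <;> simp [hcre, hcim]
    rw [this, Complex.norm_real, Real.norm_eq_abs, abs_of_nonpos (by linarith)]
    ring
  have key := Complex.borelCaratheodory (f := fun w => f (c + w)) (z := z - c) (R := 0.6)
    (M := Real.exp l / 2 + 3 / 2) (by linarith) (fun w hw => by
      obtain ⟨h1, h2, h3⟩ := hball w hw
      have := (h.hasDerivAt (c + w) ⟨h1, by linarith [h.wide]⟩).comp_const_add c w
      exact this.differentiableAt.differentiableWithinAt)
    (fun w hw => by
      obtain ⟨h1, h2, h3⟩ := hball w hw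
      exact h.re_le h1 h2 h3) (by norm_num) (by rw [mem_ball_zero_iff, hw]; linarith)
  simp only [add_sub_cancel, add_zero, hw] at key
  have hc : ‖f c‖ ≤ 5 / 2 := h.norm_le_of_re_ge hcre.ge (by rwa [hcim])
  have hinv : 1 / (0.6 - r) ≤ 2 * l := by
    rw [div_le_iff₀ hdpos]
    have : 2 * l * (0.5 / l) = 1 := by field_simp; norm_num
    nlinarith
  -- As r = 0.6 - 1/v, the Borel–Carathéodory bound becomes linear in v ≤ 2l.
  set v := 1 / (0.6 - r)
  have e1 : 2 * (Real.exp l / 2 + 3 / 2) * r / (0.6 - r) = (Real.exp l + 3) * (0.6 * v - 1) := by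
    simp only [v]; field_simp; ring
  have e2 : ‖f c‖ * (0.6 + r) / (0.6 - r) = ‖f c‖ * (1.2 * v - 1) := by
    simp only [v]; field_simp; ring
  have hv : 1 ≤ 1.2 * v := by
    simp only [v]
    rw [mul_one_div, le_div_iff₀ hdpos]
    simp only [r]
    linarith
  rw [e1, e2] at key
  have b1 : (Real.exp l + 3) * (0.6 * v - 1) ≤ (Real.exp l + 3) * (0.6 * (2 * l) - 1) := by
    gcongr
  have b2 : ‖f c‖ * (1.2 * v - 1) ≤ 5 / 2 * (1.2 * (2 * l) - 1) := by
    gcongr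
  have hquad := Real.quadratic_le_exp_of_nonneg (x := l) (by linarith)
  nlinarith [sq_nonneg (l - 2.75),
    mul_nonneg (by linarith : 0 ≤ l) (by linarith : 0 ≤ Real.exp l - 9)]

theorem mem_halfStrip (h : IsLogOnStrip χ t l W f) {z : ℂ} (hz : 1 / 2 < z.re)
    (hzt : |z.im - t| ≤ 5 * l + 1) : z ∈ halfStrip t W := ⟨hz, by linarith [h.wide]⟩

/-- Cauchy's estimate for the logarithmic derivative on a circle of radius `0.5 / l`. -/
theorem norm_dirichletLogDeriv_le (h : IsLogOnStrip χ t l W f) {x C : ℝ} (hx : 1 / 2 < x)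
    (hf : ∀ z : ℂ, x ≤ z.re → |z.im - t| ≤ 5 * l + 1 → ‖f z‖ ≤ C) {z : ℂ}
    (hz : x + 0.5 / l ≤ z.re) (hzt : |z.im - t| ≤ 5 * l) :
    ‖dirichletLogDeriv χ z‖ ≤ 2 * l * C := by
  have hl := h.two_le
  have hr : 0 < 0.5 / l := by positivity
  have hr1 : 0.5 / l ≤ 1 := by rw [div_le_one (by linarith)]; linarith
  have hball : ∀ w ∈ Metric.closedBall z (0.5 / l), x ≤ w.re ∧ |w.im - t| ≤ 5 * l + 1 := by
    intro w hw
    rw [mem_closedBall_iff_norm] at hw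
    have h1 := abs_le.1 ((Complex.abs_re_le_norm (w - z)).trans hw)
    have h2 := (Complex.abs_im_le_norm (w - z)).trans hw
    rw [Complex.sub_re] at h1
    rw [Complex.sub_im] at h2
    refine ⟨by linarith [h1.1], ?_⟩
    have : w.im - t = (w.im - z.im) + (z.im - t) := by ring
    rw [this]
    exact (abs_add_le _ _).trans (by linarith)
  have hd : ∀ w ∈ Metric.closedBall z (0.5 / l), HasDerivAt f (dirichletLogDeriv χ w) w :=
    fun w hw => h.hasDerivAt w (h.mem_halfStrip (by linarith [(hball w hw).1]) (hball w hw).2)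
  rw [← (hd z (Metric.mem_closedBall_self hr.le)).deriv]
  refine (Complex.norm_deriv_le_of_forall_mem_sphere_norm_le hr
    (DifferentiableOn.diffContOnCl fun w hw => ?_) fun w hw => ?_).trans_eq
    (b := C / (0.5 / l)) (by field_simp; ring)
  · exact (hd w (Metric.closure_ball_subset_closedBall hw)).differentiableAt.differentiableWithinAt
  · obtain ⟨h1, h2⟩ := hball w (Metric.sphere_subset_closedBall hw)
    exact hf w h1 h2

theorem norm_le_interpolated (h : IsLogOnStrip χ t l W f) {σ : ℝ} (h₀ : 1 / 2 + 0.5 / l ≤ σ)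
    (h₁ : σ ≤ 1 + 0.5 / l) :
    ‖f (σ + t * Complex.I)‖ ≤ 1.85 * l * 2.75 * Real.exp l ^ (2 * (1 - σ)) := by
  have hl := h.two_le
  have hpos : 0 < 0.5 / l := by positivity
  refine (norm_le_of_strip (F := f) (B := 0.5) (by linarith) (by linarith : 0 ≤ 1.85 * l)
    (fun z hz hzt => ?_) (fun z hz hzt => h.norm_le hz (by linarith))
    (fun z hz hzt => h.norm_le_right hz (by linarith)) h₀ h₁).trans ?_
  · exact (h.hasDerivAt z (h.mem_halfStrip (by linarith) (by linarith))).differentiableAt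
  · gcongr
    exact exp_bounds.2.2.2.2.1

/-- The margin 1.0051/l leaves room for two margins 0.5/l: one for the bound on f, one for the
Cauchy radius. The constant is 3.7 = 2·1.85. -/
theorem norm_dirichletLogDeriv_le_interpolated (h : IsLogOnStrip χ t l W f) {σ : ℝ}
    (h₀ : 1 / 2 + 1.0051 / l ≤ σ) (h₁ : σ ≤ 1 + 1.0051 / l) :
    ‖dirichletLogDeriv χ (σ + t * Complex.I)‖ ≤
      3.7 * l ^ 2 * 7.6 * Real.exp l ^ (2 * (1 - σ)) := by
  have hl := h.two_le
  have hpos : 0 < 0.5 / l := by positivity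
  have hB : 0.5 / l + 0.5 / l ≤ 1.0051 / l := by rw [← add_div]; gcongr; norm_num
  refine (norm_le_of_strip (F := dirichletLogDeriv χ) (B := 1.0051) (by linarith)
    (by positivity : 0 ≤ 3.7 * l ^ 2) (fun z hz hzt => ?_) (fun z hz hzt => ?_)
    (fun z hz hzt => ?_) h₀ h₁).trans ?_
  · have hL := DirichletCharacter.differentiable_LFunction h.ne_one
    have hmem := h.mem_halfStrip (z := z) (by linarith) (by linarith)
    exact (hL.deriv z).div (hL z) (h.exp_eq z hmem ▸ Complex.exp_ne_zero _)
  · refine (h.norm_dirichletLogDeriv_le (by linarith) (fun w a b => h.norm_le a b) (by linarith)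
      hzt).trans_eq (by ring)
  · refine (h.norm_dirichletLogDeriv_le (by linarith) (fun w a b => h.norm_le_right a b)
      (by linarith) hzt).trans_eq (by ring)
  · gcongr
    exact exp_bounds.2.2.2.2.2

end IsLogOnStrip

/-! ### Absorbing the constants and conclusion -/

/-- Since b ≤ 1 and the exponent is at most 1, b^x ≥ b: inserting b into the base loses at most a
factor b. -/
theorem le_const_rpow {b L x c d : ℝ} (hb0 : 0 < b) (hb1 : b ≤ 1) (hL : 0 ≤ L) (hx : x ≤ 1)
    (hd : 0 ≤ d) (hcd : c ≤ d * b) : c * L ^ x ≤ d * (b * L) ^ x := by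
  rw [Real.mul_rpow hb0.le hL, ← mul_assoc]
  refine mul_le_mul_of_nonneg_right (hcd.trans ?_) (Real.rpow_nonneg hL _)
  refine mul_le_mul_of_nonneg_left ?_ hd
  simpa using Real.rpow_le_rpow_of_exponent_ge hb0 hb1 hx

theorem corollary2 :
    ∃ b₁ b₂ : ℝ, (0.95 < b₁ ∧ b₁ < 0.951) ∧ (0.97 < b₂ ∧ b₂ < 0.971) ∧
      ∀ (q : ℕ) [NeZero q] (χ : DirichletCharacter ℂ q) (t : ℝ),
        2 ≤ q → χ.IsPrimitive →
        10450 + 10 ^ 3 * Real.log (Real.log q) ≤ |t| →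
        (∀ z ∈ regionR (10 ^ 3) q t, DirichletCharacter.LFunction χ z ≠ 0) →
        (∀ σ ∈ regionS 0.5 0.5 q t,
          ‖dirichletLog χ (σ + t * Complex.I)‖ ≤
            5.44 * (b₁ * Real.log (q * |t|)) ^ (2 * (1 - σ)) *
              Real.log (Real.log (q * |t|))) ∧
        (∀ σ ∈ regionS 1.0051 0.3349 q t,
          ‖dirichletLogDeriv χ (σ + t * Complex.I)‖ ≤
            33.281 * (b₂ * Real.log (q * |t|)) ^ (2 * (1 - σ)) *
              Real.log (Real.log (q * |t|)) ^ 2) := by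
  -- Midpoints of the allowed intervals; all that is needed is 1.85·2.75 ≤ 5.44 b₁ and 3.7·7.6 ≤
  -- 33.281 b₂.
  refine ⟨0.9505, 0.9705, by norm_num, by norm_num, ?_⟩
  intro q _ χ t hq hprim ht hzero
  have hχ : χ ≠ 1 := by
    -- The trivial character has conductor 1, so it is primitive only for q = 1.
    rintro rfl
    rw [DirichletCharacter.isPrimitive_def, DirichletCharacter.conductor_one] at hprim
    omega
  obtain ⟨hT, hL, hl2, hnarrow, hmono⟩ := log_log_estimates hq ht
  simp only [regionS]
  set L := Real.log (q * |t|)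
  set l := Real.log L
  have hLl : L = Real.exp l := (Real.exp_log (by linarith)).symm
  have hne : ∀ z ∈ halfStrip t (10 ^ 3 * l + 3), DirichletCharacter.LFunction χ z ≠ 0 :=
    fun z hz => hzero z ⟨hz.1, hz.2.le.trans (by gcongr)⟩
  obtain ⟨f, hf1, hf2, hf3, hf4⟩ :=
    exists_logarithm_LFunction hχ (by linarith : 0 < 10 ^ 3 * l + 3) hne
  have h : IsLogOnStrip χ t l (10 ^ 3 * l + 3) f :=
    ⟨hq, hχ, hT, hLl, hl2, hLl ▸ hL, hnarrow, by linarith, hf1, hf2, hf3⟩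
  have hhalf {A : ℝ} (hA : 0 < A) {σ : ℝ} (hσ : 1 / 2 + A / l ≤ σ) : 1 / 2 < σ := by
    have : 0 < A / l := by positivity
    linarith
  refine ⟨fun σ hσ => ?_, fun σ hσ => ?_⟩
  · have hmem : (σ + t * Complex.I : ℂ) ∈ halfStrip t (10 ^ 3 * l + 3) :=
      h.mem_halfStrip (by simpa using hhalf (by norm_num) hσ.1) (by simp; linarith)
    rw [← hf4 _ hmem]
    refine (h.norm_le_interpolated hσ.1 hσ.2).trans ?_
    have := le_const_rpow (b := 0.9505) (L := L) (x := 2 * (1 - σ)) (c := 1.85 * 2.75) (d := 5.44)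
      (by norm_num) (by norm_num) (by linarith) (by linarith [hhalf (by norm_num) hσ.1])
      (by norm_num) (by norm_num)
    rw [← hLl]
    nlinarith
  · have hσ2 : σ ≤ 1 + 1.0051 / l := hσ.2.trans (by gcongr; norm_num)
    refine (h.norm_dirichletLogDeriv_le_interpolated hσ.1 hσ2).trans ?_
    have := le_const_rpow (b := 0.9705) (L := L) (x := 2 * (1 - σ)) (c := 3.7 * 7.6) (d := 33.281)
      (by norm_num) (by norm_num) (by linarith) (by linarith [hhalf (by norm_num) hσ.1])
      (by norm_num) (by norm_num)
    rw [← hLl]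
    nlinarith [mul_le_mul_of_nonneg_right this (sq_nonneg l)]
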